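/- Let \(n\ge 0\) be an integer, let \(C\) and \(R\) be \(n\times n\) complex positive definite (Hermitian) matrices, and suppose that \(R<I\), i.e. \(S:=I-R\) is also positive definite. For positive definite \(A,B\) let \[ A\# B=A^{1/2}\bigl(A^{-1/2}BA^{-1/2}\bigr)^{1/2}A^{1/2} \] denote the Kubo--Ando geometric mean, where \(X^{1/2}\) is the positive semidefinite square root, and put \[ \Phi_R(C)=RCR+SCS+2\bigl(RCR\,\#\,SCS\bigr). \] For a Hermitian matrix \(T\) let \(\lambda(T)\in\mathbb R^n\) be the vector of its eigenvalues, counted with multiplicity and arranged in decreasing order; for \(x,y\in\mathbb R^n\) with decreasing rearrangements \(x^\downarrow,y^\downarrow\), write \(x\prec_w y\) if \(\sum_{j=1}^k x_j^\downarrow\le\sum_{j=1}^k y_j^\downarrow\) for all \(1\le k\le n\). Then \(\Phi_R(C)\) is positive definite and \[ \lambda\bigl(\Phi_R(C)\bigr)\prec_w\lambda(C). \] -/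

import Mathlib

open scoped MatrixOrder ComplexOrder

namespace NonlinearPinching

/-- The midpoint Kubo-Ando (metric) geometric mean
`A # B = A^{1/2} (A^{-1/2} B A^{-1/2})^{1/2} A^{1/2}` of two positive definite matrices;
`CFC.sqrt` is the positive semidefinite square root. -/
noncomputable def geometricMean {n : ℕ} (A B : Matrix (Fin n) (Fin n) ℂ) :
    Matrix (Fin n) (Fin n) ℂ :=
  CFC.sqrt A * CFC.sqrt ((CFC.sqrt A)⁻¹ * B * (CFC.sqrt A)⁻¹) * CFC.sqrt A

/-- The nonlinear pinching map `Φ_R(C) = R C R + S C S + 2 (R C R # S C S)`, with `S = I - R`. -/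
noncomputable def pinchingMap {n : ℕ} (R C : Matrix (Fin n) (Fin n) ℂ) :
    Matrix (Fin n) (Fin n) ℂ :=
  R * C * R + (1 - R) * C * (1 - R) +
    (2 : ℂ) • geometricMean (R * C * R) ((1 - R) * C * (1 - R))

/-- The eigenvalues of a Hermitian matrix, with multiplicity, in decreasing order. -/
noncomputable def eigenvalueVector {n : ℕ} {A : Matrix (Fin n) (Fin n) ℂ}
    (hA : A.IsHermitian) : Fin n → ℝ :=
  fun i => hA.eigenvalues₀ (Fin.cast (Fintype.card_fin n).symm i)

/-- The decreasing rearrangement of a real vector (`Tuple.sort x` sorts `x` increasingly). -/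
noncomputable def decreasingRearrangement {n : ℕ} (x : Fin n → ℝ) : Fin n → ℝ :=
  fun i => x (Tuple.sort x i.rev)

/-- Weak majorization `x ≺_w y`: for `1 ≤ k ≤ n`, the sum of the `k` largest entries of `x` is
at most the sum of the `k` largest entries of `y`. -/
def WeaklyMajorizedBy {n : ℕ} (x y : Fin n → ℝ) : Prop :=
  ∀ k : ℕ, 1 ≤ k → k ≤ n →
    ∑ j : Fin n with j.val < k, decreasingRearrangement x j ≤
      ∑ j : Fin n with j.val < k, decreasingRearrangement y j

end NonlinearPinching

namespace NonlinearPinching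

open Matrix

/-! The map `Φ_R` is monotone, dominates scalars (`Φ_R(t) ≥ t`) and does not increase the trace;
these three facts suffice. Let `t` be the `k`-th largest eigenvalue of `C`, and let `B` be `C` with
its eigenvalues raised to at least `t`, so that `B ≥ C` and `B ≥ t`. If `P` is the spectral
projection for the top `k` eigenvalues of `Φ_R(C)`, their sum is `tr PΦ_R(C) ≤ tr PΦ_R(B) = tr
Φ_R(B) - tr (1-P)Φ_R(B) ≤ tr B - t(n-k)`, which is the sum of the top `k` eigenvalues of `C`.
Monotonicity comes from the extremal characterization of the geometric mean (`le_geometricMean`),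
and the trace bound from a weighted arithmetic-geometric mean inequality
(`two_mul_trace_geometricMean_le`). -/

theorem le_iff_posSemidef {n : ℕ} {A B : Matrix (Fin n) (Fin n) ℂ} :
    A ≤ B ↔ (B - A).PosSemidef :=
  Matrix.le_iff

/-! ### Trace pairing of positive semidefinite matrices -/

section Trace

variable {n : ℕ} {A B P : Matrix (Fin n) (Fin n) ℂ}

/-- The trace of a product of two positive semidefinite matrices is nonnegative. -/
theorem trace_mul_nonneg (hP : P.PosSemidef) (hA : A.PosSemidef) : 0 ≤ (P * A).trace := by
  obtain ⟨L, rfl⟩ := CStarAlgebra.nonneg_iff_eq_star_mul_self.mp hP.nonneg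
  rw [Matrix.mul_assoc, Matrix.trace_mul_comm]
  exact (hA.mul_mul_conjTranspose_same L).trace_nonneg

theorem trace_mul_le_trace_mul (hP : P.PosSemidef) (hAB : A ≤ B) :
    (P * A).trace ≤ (P * B).trace := by
  have h := trace_mul_nonneg hP (le_iff_posSemidef.mp hAB)
  rwa [Matrix.mul_sub, Matrix.trace_sub, sub_nonneg] at h

end Trace

/-! ### The geometric mean: Riccati equation, maximality, monotonicity -/

section GeometricMean

variable {n : ℕ} {A B X A' B' : Matrix (Fin n) (Fin n) ℂ}

open scoped Matrix.Norms.L2Operator in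
theorem sqrt_le_sqrt (h : A ≤ B) : CFC.sqrt A ≤ CFC.sqrt B := CFC.sqrt_le_sqrt A B h

theorem isUnit_det_sqrt (hA : A.PosDef) : IsUnit (CFC.sqrt A).det :=
  (Matrix.isUnit_iff_isUnit_det _).mp
    ((CFC.isUnit_sqrt_iff A hA.posSemidef.nonneg).mpr hA.isUnit)

theorem isHermitian_sqrt (A : Matrix (Fin n) (Fin n) ℂ) : (CFC.sqrt A).IsHermitian :=
  (Matrix.nonneg_iff_posSemidef.mp (CFC.sqrt_nonneg A)).isHermitian

theorem inv_sqrt_mul_inv_sqrt (hA : A.PosDef) : (CFC.sqrt A)⁻¹ * (CFC.sqrt A)⁻¹ = A⁻¹ := by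
  rw [← Matrix.mul_inv_rev, CFC.sqrt_mul_sqrt_self A hA.posSemidef.nonneg]

theorem posSemidef_inv_sqrt_conj (A : Matrix (Fin n) (Fin n) ℂ) (hX : X.PosSemidef) :
    ((CFC.sqrt A)⁻¹ * X * (CFC.sqrt A)⁻¹).PosSemidef := by
  have h := hX.mul_mul_conjTranspose_same (CFC.sqrt A)⁻¹
  rwa [(isHermitian_sqrt A).inv.eq] at h

theorem posSemidef_geometricMean (A B : Matrix (Fin n) (Fin n) ℂ) :
    (geometricMean A B).PosSemidef := by
  have h := (Matrix.nonneg_iff_posSemidef.mp (CFC.sqrt_nonneg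
    ((CFC.sqrt A)⁻¹ * B * (CFC.sqrt A)⁻¹))).mul_mul_conjTranspose_same (CFC.sqrt A)
  rwa [(isHermitian_sqrt A).eq] at h

/-- The geometric mean solves the Riccati equation `G A⁻¹ G = B`. -/
theorem geometricMean_mul_inv_mul (hA : A.PosDef) (hB : B.PosSemidef) :
    geometricMean A B * A⁻¹ * geometricMean A B = B := by
  have hu := isUnit_det_sqrt hA
  have hq := CFC.sqrt_mul_sqrt_self _ (posSemidef_inv_sqrt_conj A hB).nonneg
  rw [← inv_sqrt_mul_inv_sqrt hA]
  unfold geometricMean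
  generalize CFC.sqrt ((CFC.sqrt A)⁻¹ * B * (CFC.sqrt A)⁻¹) = Q at hq ⊢
  generalize CFC.sqrt A = S at hu hq ⊢
  calc S * Q * S * (S⁻¹ * S⁻¹) * (S * Q * S)
      = S * Q * (S * S⁻¹) * (S⁻¹ * S) * Q * S := by simp only [Matrix.mul_assoc]
    _ = S * (Q * Q) * S := by
        rw [Matrix.mul_nonsing_inv _ hu, Matrix.nonsing_inv_mul _ hu]
        simp only [Matrix.mul_assoc, Matrix.one_mul]
    _ = (S * S⁻¹) * B * (S⁻¹ * S) := by rw [hq]; simp only [Matrix.mul_assoc]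
    _ = B := by
        rw [Matrix.mul_nonsing_inv _ hu, Matrix.nonsing_inv_mul _ hu, Matrix.one_mul,
          Matrix.mul_one]

/-- The geometric mean dominates every positive semidefinite `X` with `X A⁻¹ X ≤ B`. -/
theorem le_geometricMean (hA : A.PosDef) (hX : X.PosSemidef) (h : X * A⁻¹ * X ≤ B) :
    X ≤ geometricMean A B := by
  have hu := isUnit_det_sqrt hA
  have hY := posSemidef_inv_sqrt_conj A hX
  -- Conjugating the hypothesis by `A^{-1/2}` bounds the square of `A^{-1/2} X A^{-1/2}`; the square
  -- root is operator monotone.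
  have hYQ : (CFC.sqrt A)⁻¹ * X * (CFC.sqrt A)⁻¹ ≤
      CFC.sqrt ((CFC.sqrt A)⁻¹ * B * (CFC.sqrt A)⁻¹) := by
    rw [← CFC.sqrt_mul_self _ hY.nonneg]
    refine sqrt_le_sqrt (le_iff_posSemidef.mpr ?_)
    convert posSemidef_inv_sqrt_conj A (le_iff_posSemidef.mp h) using 1
    rw [← inv_sqrt_mul_inv_sqrt hA]
    noncomm_ring
  have hc := (le_iff_posSemidef.mp hYQ).mul_mul_conjTranspose_same (CFC.sqrt A)
  rw [(isHermitian_sqrt A).eq] at hc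
  refine le_iff_posSemidef.mpr ?_
  convert hc using 1
  rw [Matrix.mul_sub, Matrix.sub_mul]
  congr 1
  generalize CFC.sqrt A = S at hu ⊢
  calc X = (S * S⁻¹) * X * (S⁻¹ * S) := by
        rw [Matrix.mul_nonsing_inv _ hu, Matrix.nonsing_inv_mul _ hu, Matrix.one_mul,
          Matrix.mul_one]
    _ = S * (S⁻¹ * X * S⁻¹) * S := by simp only [Matrix.mul_assoc]

/-- Schur complement: this turns the quadratic condition on `X` into one that is jointly linear in
`A`, `X`, `B`. -/
theorem posSemidef_fromBlocks_iff (hA : A.PosDef) (hX : X.IsHermitian) :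
    (Matrix.fromBlocks A X X B).PosSemidef ↔ X * A⁻¹ * X ≤ B := by
  let := hA.isUnit.invertible
  have h := Matrix.PosDef.fromBlocks₁₁ X B hA
  rwa [hX.eq] at h

/-- The geometric mean is monotone in both arguments. -/
theorem geometricMean_mono (hA : A.PosDef) (hB : B.PosSemidef) (hAA' : A ≤ A') (hBB' : B ≤ B') :
    geometricMean A B ≤ geometricMean A' B' := by
  have hG := posSemidef_geometricMean A B
  have hA' : A'.PosDef := by
    simpa using hA.add_posSemidef (le_iff_posSemidef.mp hAA')
  refine le_geometricMean hA' hG ((posSemidef_fromBlocks_iff hA' hG.isHermitian).mp ?_)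
  have h₁ := (posSemidef_fromBlocks_iff hA hG.isHermitian).mpr
    (geometricMean_mul_inv_mul hA hB).le
  -- Adding this block-diagonal increment replaces `A`, `B` by `A'`, `B'` and keeps the off-diagonal
  -- `G`, so `G` stays admissible for the larger pair.
  have h₂ : (Matrix.fromBlocks (A' - A) 0 0 (B' - B)).PosSemidef := by
    obtain ⟨L, hL⟩ := CStarAlgebra.nonneg_iff_eq_star_mul_self.mp (le_iff_posSemidef.mp hAA').nonneg
    obtain ⟨M, hM⟩ := CStarAlgebra.nonneg_iff_eq_star_mul_self.mp (le_iff_posSemidef.mp hBB').nonneg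
    have h := Matrix.posSemidef_conjTranspose_mul_self (Matrix.fromBlocks L 0 0 M)
    rw [hL, hM]
    simpa [Matrix.fromBlocks_conjTranspose, Matrix.fromBlocks_multiply,
      Matrix.star_eq_conjTranspose] using h
  have h := h₁.add h₂
  simpa [Matrix.fromBlocks_add] using h

/-- A weighted arithmetic-geometric mean inequality for the trace. -/
theorem two_mul_trace_geometricMean_le {P P' : Matrix (Fin n) (Fin n) ℂ} (hA : A.PosDef)
    (hB : B.PosSemidef) (hP : P.IsHermitian) (hP' : P'.PosSemidef) (hPP' : P * P' = 1) :
    2 * (geometricMean A B).trace ≤ (A * P).trace + (P' * B).trace := by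
  have hu := (Matrix.isUnit_iff_isUnit_det _).mp hA.isUnit
  have hG := posSemidef_geometricMean A B
  have hRic := geometricMean_mul_inv_mul hA hB
  generalize geometricMean A B = G at hG hRic ⊢
  -- The inequality is the expansion of `tr P'(G - PA)A⁻¹(G - PA)ᴴ ≥ 0`, using `G A⁻¹ G = B` and `P'
  -- = P⁻¹`.
  have hpos := trace_mul_nonneg hP'
    (hA.inv.posSemidef.mul_mul_conjTranspose_same (G - P * A))
  have hexp : (G - P * A) * A⁻¹ * (G - P * A)ᴴ = B - G * P - P * G + P * A * P := by
    rw [Matrix.conjTranspose_sub, Matrix.conjTranspose_mul, hG.isHermitian.eq,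
      hA.isHermitian.eq, hP.eq, ← hRic]
    have h₁ : P * A * A⁻¹ = P := by
      rw [Matrix.mul_assoc, Matrix.mul_nonsing_inv _ hu, Matrix.mul_one]
    have h₂ : G * A⁻¹ * (A * P) = G * P := by
      rw [Matrix.mul_assoc, ← Matrix.mul_assoc A⁻¹, Matrix.nonsing_inv_mul _ hu, Matrix.one_mul]
    rw [Matrix.sub_mul, h₁, Matrix.mul_sub, Matrix.sub_mul, Matrix.sub_mul, h₂]
    noncomm_ring
  have hP'P : P' * P = 1 := mul_eq_one_comm.mp hPP'
  have h₁ : (P' * (G * P)).trace = G.trace := by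
    rw [Matrix.trace_mul_comm, Matrix.mul_assoc, hPP', Matrix.mul_one]
  have h₂ : P' * (P * G) = G := by rw [← Matrix.mul_assoc, hP'P, Matrix.one_mul]
  have h₃ : P' * (P * A * P) = A * P := by
    rw [Matrix.mul_assoc P, ← Matrix.mul_assoc P', hP'P, Matrix.one_mul]
  rw [hexp, Matrix.mul_add, Matrix.mul_sub, Matrix.mul_sub, h₂, h₃, Matrix.trace_add,
    Matrix.trace_sub, Matrix.trace_sub, h₁] at hpos
  rw [← sub_nonneg]
  convert hpos using 1
  ring

end GeometricMean

/-! ### The three properties of the pinching map -/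

section PinchingMap

variable {n : ℕ} {R C D : Matrix (Fin n) (Fin n) ℂ}

theorem posDef_conj (hR : R.PosDef) (hC : C.PosDef) : (R * C * R).PosDef := by
  have h := (Matrix.IsUnit.posDef_star_right_conjugate_iff (x := C) hR.isUnit).mpr hC
  rwa [Matrix.star_eq_conjTranspose, hR.isHermitian.eq] at h

theorem conj_le_conj (hR : R.IsHermitian) (hCD : C ≤ D) : R * C * R ≤ R * D * R := by
  have h := (le_iff_posSemidef.mp hCD).mul_mul_conjTranspose_same R
  rwa [hR.eq, Matrix.mul_sub, Matrix.sub_mul] at h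

theorem posDef_pinchingMap (hC : C.PosDef) (hR : R.PosDef) (hS : (1 - R).PosDef) :
    (pinchingMap R C).PosDef :=
  ((posDef_conj hR hC).add (posDef_conj hS hC)).add_posSemidef
    ((posSemidef_geometricMean _ _).smul (by norm_num))

theorem pinchingMap_mono (hC : C.PosDef) (hR : R.PosDef) (hS : (1 - R).PosDef) (hCD : C ≤ D) :
    pinchingMap R C ≤ pinchingMap R D := by
  have h₁ := conj_le_conj hR.isHermitian hCD
  have h₂ := conj_le_conj hS.isHermitian hCD
  have h₃ := geometricMean_mono (posDef_conj hR hC) (posDef_conj hS hC).posSemidef h₁ h₂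
  have h₄ : (2 : ℂ) • geometricMean (R * C * R) ((1 - R) * C * (1 - R)) ≤
      (2 : ℂ) • geometricMean (R * D * R) ((1 - R) * D * (1 - R)) := by
    rw [le_iff_posSemidef, ← smul_sub]
    exact (le_iff_posSemidef.mp h₃).smul (by norm_num)
  exact add_le_add (add_le_add h₁ h₂) h₄

/-- With `S = 1 - R` commuting with `R`, `RS = RS(R + S) = RSR + SRS`. -/
theorem posSemidef_mul_one_sub (hR : R.PosDef) (hS : (1 - R).PosDef) :
    (R * (1 - R)).PosSemidef := by
  convert (posDef_conj hR hS).posSemidef.add (posDef_conj hS hR).posSemidef using 1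
  noncomm_ring

/-- Since `R` and `S = 1 - R` commute, `X = tRS` satisfies `X(tR²)⁻¹X = tS²`, so the mean is at
least `tRS`, and `t(R² + S² + 2RS) = t(R + S)² = t`. -/
theorem smul_one_le_pinchingMap {t : ℂ} (ht : 0 < t) (hR : R.PosDef) (hS : (1 - R).PosDef) :
    t • (1 : Matrix (Fin n) (Fin n) ℂ) ≤ pinchingMap R (t • 1) := by
  have hu := (Matrix.isUnit_iff_isUnit_det _).mp hR.isUnit
  have ht1 : (t • (1 : Matrix (Fin n) (Fin n) ℂ)).PosDef := Matrix.PosDef.one.smul ht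
  have hG : t • (R * (1 - R)) ≤
      geometricMean (R * (t • 1) * R) ((1 - R) * (t • 1) * (1 - R)) := by
    refine le_geometricMean (posDef_conj hR ht1) ((posSemidef_mul_one_sub hR hS).smul ht.le)
      (le_of_eq ?_)
    have hinv : (R * (t • 1) * R)⁻¹ = t⁻¹ • (R⁻¹ * R⁻¹) := by
      apply Matrix.inv_eq_right_inv
      simp only [Matrix.mul_smul, Matrix.smul_mul, Matrix.mul_one, smul_smul]
      rw [inv_mul_cancel₀ ht.ne', one_smul, Matrix.mul_assoc, ← Matrix.mul_assoc R R⁻¹,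
        Matrix.mul_nonsing_inv _ hu, Matrix.one_mul, Matrix.mul_nonsing_inv _ hu]
    have hcomm : R * (1 - R) = (1 - R) * R := by noncomm_ring
    rw [hinv]
    simp only [Matrix.mul_smul, Matrix.smul_mul, Matrix.mul_one, smul_smul]
    rw [mul_inv_cancel_left₀ ht.ne']
    congr 1
    calc R * (1 - R) * (R⁻¹ * R⁻¹) * (R * (1 - R))
        = (1 - R) * (R * R⁻¹) * (R⁻¹ * R) * (1 - R) := by
          nth_rewrite 1 [hcomm]; simp only [Matrix.mul_assoc]
      _ = (1 - R) * (1 - R) := by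
          rw [Matrix.mul_nonsing_inv _ hu, Matrix.nonsing_inv_mul _ hu, Matrix.mul_one,
            Matrix.mul_one]
  have h2 : (2 : ℂ) • (t • (R * (1 - R))) ≤
      (2 : ℂ) • geometricMean (R * (t • 1) * R) ((1 - R) * (t • 1) * (1 - R)) := by
    rw [le_iff_posSemidef, ← smul_sub]
    exact (le_iff_posSemidef.mp hG).smul (by norm_num)
  refine le_trans (le_of_eq ?_) (add_le_add_right h2 _)
  simp only [Matrix.mul_smul, Matrix.smul_mul, Matrix.mul_one]
  rw [smul_comm (2 : ℂ) t, ← smul_add, ← smul_add, two_smul]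
  congr 1
  noncomm_ring

/-- The weight `P = R⁻¹ - 1 = R⁻¹S` has inverse `S⁻¹R = S⁻¹ - 1`, and makes both terms of the trace
inequality equal to `tr RCS`; the total then collapses to `tr C`. -/
theorem trace_pinchingMap_le (hC : C.PosDef) (hR : R.PosDef) (hS : (1 - R).PosDef) :
    (pinchingMap R C).trace ≤ C.trace := by
  have huR := (Matrix.isUnit_iff_isUnit_det _).mp hR.isUnit
  have huS := (Matrix.isUnit_iff_isUnit_det _).mp hS.isUnit
  have hRR := Matrix.mul_nonsing_inv _ huR
  have hRR' := Matrix.nonsing_inv_mul _ huR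
  have hSS := Matrix.mul_nonsing_inv _ huS
  have hSS' := Matrix.nonsing_inv_mul _ huS
  have hP : (R⁻¹ - 1).IsHermitian := hR.isHermitian.inv.sub Matrix.isHermitian_one
  have hP' : ((1 - R)⁻¹ - 1).PosSemidef := by
    have h := (posSemidef_mul_one_sub hR hS).mul_mul_conjTranspose_same (1 - R)⁻¹
    rw [hS.inv.isHermitian.eq] at h
    convert h using 1
    calc (1 - R)⁻¹ - 1 = (1 - R)⁻¹ - (1 - R)⁻¹ * (1 - R) := by rw [hSS']
      _ = (1 - R)⁻¹ * R := by noncomm_ring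
      _ = (1 - R)⁻¹ * R * ((1 - R) * (1 - R)⁻¹) := by rw [hSS, Matrix.mul_one]
      _ = _ := by simp only [Matrix.mul_assoc]
  have hPP' : (R⁻¹ - 1) * ((1 - R)⁻¹ - 1) = 1 := by
    have e₁ : R⁻¹ - 1 = R⁻¹ * (1 - R) := by rw [Matrix.mul_sub, hRR', Matrix.mul_one]
    have e₂ : (1 - R)⁻¹ - 1 = (1 - R)⁻¹ * R := by
      calc (1 - R)⁻¹ - 1 = (1 - R)⁻¹ - (1 - R)⁻¹ * (1 - R) := by rw [hSS']
        _ = _ := by noncomm_ring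
    rw [e₁, e₂, Matrix.mul_assoc, ← Matrix.mul_assoc (1 - R), hSS, Matrix.one_mul, hRR']
  have h := two_mul_trace_geometricMean_le (posDef_conj hR hC) (posDef_conj hS hC).posSemidef
    hP hP' hPP'
  have e₁ : R * C * R * (R⁻¹ - 1) = R * C - R * C * R := by
    rw [Matrix.mul_sub, Matrix.mul_assoc (R * C), hRR, Matrix.mul_one, Matrix.mul_one]
  have e₂ : ((1 - R)⁻¹ - 1) * ((1 - R) * C * (1 - R)) = R * C * (1 - R) := by
    calc _ = ((1 - R)⁻¹ * (1 - R)) * C * (1 - R) - (1 - R) * C * (1 - R) := by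
          rw [Matrix.sub_mul]; simp only [Matrix.mul_assoc, Matrix.one_mul]
      _ = _ := by rw [hSS']; noncomm_ring
  rw [e₁, e₂] at h
  unfold pinchingMap
  rw [Matrix.trace_add, Matrix.trace_smul, smul_eq_mul]
  refine (add_le_add_right h _).trans (le_of_eq ?_)
  rw [← Matrix.trace_add, ← Matrix.trace_add]
  have e₃ : R * C * R + (1 - R) * C * (1 - R) + (R * C - R * C * R + R * C * (1 - R)) =
      C + (R * C - C * R) := by noncomm_ring
  rw [e₃, Matrix.trace_add, Matrix.trace_sub, Matrix.trace_mul_comm R C, sub_self, add_zero]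

end PinchingMap

/-! ### Ordered eigenvalues, truncation and top projections -/

section Spectrum

variable {n : ℕ} {A : Matrix (Fin n) (Fin n) ℂ}

theorem decreasingRearrangement_of_antitone {x : Fin n → ℝ} (hx : Antitone x) :
    decreasingRearrangement x = x := by
  have h : x ∘ (Fin.revPerm : Equiv.Perm (Fin n)) = x ∘ Tuple.sort x :=
    Tuple.comp_sort_eq_comp_iff_monotone.mpr fun i j hij => hx (Fin.rev_le_rev.mpr hij)
  funext i
  simpa [decreasingRearrangement] using (congrFun h i.rev).symm

theorem antitone_eigenvalueVector (hA : A.IsHermitian) : Antitone (eigenvalueVector hA) :=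
  fun _ _ hij => hA.eigenvalues₀_antitone (by simpa using hij)

/-- Diagonalization of a Hermitian matrix with its eigenvalues in decreasing order. -/
theorem exists_unitary_diagonalization (hA : A.IsHermitian) :
    ∃ U : Matrix (Fin n) (Fin n) ℂ, U * Uᴴ = 1 ∧ Uᴴ * U = 1 ∧
      A = U * diagonal (fun i => (eigenvalueVector hA i : ℂ)) * Uᴴ := by
  -- `eigenvalues` is indexed through a chosen equivalence, so the columns must be permuted to
  -- restore decreasing order.
  let e : Equiv.Perm (Fin n) :=
    (finCongr (Fintype.card_fin n).symm).trans (Fintype.equivOfCardEq (Fintype.card_fin _))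
  have he : ∀ i, hA.eigenvalues (e i) = eigenvalueVector hA i := by
    intro i
    simp [e, Matrix.IsHermitian.eigenvalues, eigenvalueVector]
  let V : Matrix (Fin n) (Fin n) ℂ := hA.eigenvectorUnitary
  have hV₁ : V * Vᴴ = 1 := Unitary.coe_mul_star_self hA.eigenvectorUnitary
  have hV₂ : Vᴴ * V = 1 := Unitary.coe_star_mul_self hA.eigenvectorUnitary
  have hV₃ : A = V * diagonal (fun i => (hA.eigenvalues i : ℂ)) * Vᴴ := by
    have h := hA.spectral_theorem
    rwa [Unitary.conjStarAlgAut_apply] at h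
  refine ⟨V.submatrix id e, ?_, ?_, ?_⟩
  · rw [Matrix.conjTranspose_submatrix, Matrix.submatrix_mul_equiv, hV₁,
      Matrix.submatrix_id_id]
  · rw [Matrix.conjTranspose_submatrix, ← Matrix.submatrix_mul _ _ _ _ _ Function.bijective_id,
      hV₂, Matrix.submatrix_one_equiv]
  · have hd : diagonal (fun i => (eigenvalueVector hA i : ℂ)) =
        (diagonal (fun i => (hA.eigenvalues i : ℂ))).submatrix e e := by
      rw [Matrix.submatrix_diagonal_equiv]
      simp [Function.comp_def, he]
    rw [hd, Matrix.conjTranspose_submatrix, Matrix.submatrix_mul_equiv,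
      Matrix.submatrix_mul_equiv, ← hV₃, Matrix.submatrix_id_id]

theorem trace_unitary_conj {U : Matrix (Fin n) (Fin n) ℂ} (hU : Uᴴ * U = 1) (d : Fin n → ℂ) :
    (U * diagonal d * Uᴴ).trace = ∑ i, d i := by
  rw [Matrix.trace_mul_comm, ← Matrix.mul_assoc, hU, Matrix.one_mul, Matrix.trace_diagonal]

theorem posSemidef_unitary_conj (U : Matrix (Fin n) (Fin n) ℂ) {d : Fin n → ℝ} (hd : ∀ i, 0 ≤ d i) :
    (U * diagonal (fun i => (d i : ℂ)) * Uᴴ).PosSemidef :=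
  (Matrix.PosSemidef.diagonal fun i => by simpa using hd i).mul_mul_conjTranspose_same U

/-- Truncating the eigenvalues of `A` from below at `t`. -/
theorem exists_truncation (hA : A.IsHermitian) (t : ℝ) :
    ∃ B : Matrix (Fin n) (Fin n) ℂ, A ≤ B ∧ (t : ℂ) • 1 ≤ B ∧
      B.trace = ((∑ i, max (eigenvalueVector hA i) t : ℝ) : ℂ) := by
  obtain ⟨U, hU₁, hU₂, hA'⟩ := exists_unitary_diagonalization hA
  generalize eigenvalueVector hA = μ at hA' ⊢
  refine ⟨U * diagonal (fun i => ((max (μ i) t : ℝ) : ℂ)) * Uᴴ, ?_, ?_, ?_⟩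
  · rw [le_iff_posSemidef]
    convert posSemidef_unitary_conj U
      (d := fun i => max (μ i) t - μ i) (by simp) using 1
    rw [hA']
    rw [← Matrix.sub_mul, ← Matrix.mul_sub, Matrix.diagonal_sub]
    simp
  · rw [le_iff_posSemidef]
    convert posSemidef_unitary_conj U
      (d := fun i => max (μ i) t - t) (by simp) using 1
    have h1 : (t : ℂ) • (1 : Matrix (Fin n) (Fin n) ℂ) = U * diagonal (fun _ => (t : ℂ)) * Uᴴ := by
      rw [← Matrix.smul_one_eq_diagonal, Matrix.mul_smul, Matrix.smul_mul, Matrix.mul_one, hU₁]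
    rw [h1, ← Matrix.sub_mul, ← Matrix.mul_sub, Matrix.diagonal_sub]
    simp
  · rw [trace_unitary_conj hU₂, Complex.ofReal_sum]

/-- The sum of the `k` largest eigenvalues is attained at a projection of trace `k`. -/
theorem exists_topProjection (hA : A.IsHermitian) (k : ℕ) :
    ∃ P : Matrix (Fin n) (Fin n) ℂ, P.PosSemidef ∧ (1 - P).PosSemidef ∧
      (1 - P).trace = ((∑ i : Fin n, if i.val < k then 0 else 1 : ℝ) : ℂ) ∧
      (P * A).trace = ((∑ i : Fin n with i.val < k, eigenvalueVector hA i : ℝ) : ℂ) := by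
  obtain ⟨U, hU₁, hU₂, hA'⟩ := exists_unitary_diagonalization hA
  generalize eigenvalueVector hA = μ at hA' ⊢
  let d : Fin n → ℝ := fun i => if i.val < k then 1 else 0
  let d' : Fin n → ℝ := fun i => if i.val < k then 0 else 1
  have hP' : 1 - U * diagonal (fun i => (d i : ℂ)) * Uᴴ =
      U * diagonal (fun i => (d' i : ℂ)) * Uᴴ := by
    rw [sub_eq_iff_eq_add, ← Matrix.add_mul, ← Matrix.mul_add, Matrix.diagonal_add]
    have : (fun i => (d' i : ℂ) + (d i : ℂ)) = fun _ => 1 := by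
      funext i
      simp only [d, d']
      split_ifs <;> simp
    rw [this, Matrix.diagonal_one, Matrix.mul_one, hU₁]
  refine ⟨U * diagonal (fun i => (d i : ℂ)) * Uᴴ, posSemidef_unitary_conj U ?_, ?_, ?_, ?_⟩
  · intro i
    simp only [d]
    split_ifs <;> simp
  · rw [hP']
    refine posSemidef_unitary_conj U fun i => ?_
    simp only [d']
    split_ifs <;> simp
  · rw [hP', trace_unitary_conj hU₂, Complex.ofReal_sum]
  · rw [hA']
    have : U * diagonal (fun i => (d i : ℂ)) * Uᴴ *
        (U * diagonal (fun i => (μ i : ℂ)) * Uᴴ) =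
        U * diagonal (fun i => (d i : ℂ) * (μ i : ℂ)) * Uᴴ := by
      rw [← Matrix.diagonal_mul_diagonal]
      calc _ = U * diagonal (fun i => (d i : ℂ)) * (Uᴴ * U) *
            diagonal (fun i => (μ i : ℂ)) * Uᴴ := by
            simp only [Matrix.mul_assoc]
        _ = _ := by rw [hU₂]; simp only [Matrix.mul_assoc, Matrix.one_mul]
    rw [this, trace_unitary_conj hU₂, Finset.sum_filter, Complex.ofReal_sum]
    refine Finset.sum_congr rfl fun i _ => ?_
    simp only [d]
    split_ifs <;> simp

theorem eigenvalueVector_pos (hA : A.PosDef) (i : Fin n) :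
    0 < eigenvalueVector hA.isHermitian i := by
  have h := hA.eigenvalues_pos
    ((Fintype.equivOfCardEq (Fintype.card_fin _)) (Fin.cast (Fintype.card_fin n).symm i))
  simpa [Matrix.IsHermitian.eigenvalues, eigenvalueVector] using h

end Spectrum

end NonlinearPinching

/-! ### Weak majorization -/

open NonlinearPinching in
theorem mainTheorem2 (n : ℕ) (C R : Matrix (Fin n) (Fin n) ℂ)
    (hC : C.PosDef) (hR : R.PosDef) (hRI : (1 - R).PosDef) :
    ∃ hΦ : (NonlinearPinching.pinchingMap R C).PosDef,
      NonlinearPinching.WeaklyMajorizedBy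
        (NonlinearPinching.eigenvalueVector hΦ.isHermitian)
        (NonlinearPinching.eigenvalueVector hC.isHermitian) := by
  refine ⟨posDef_pinchingMap hC hR hRI, fun k hk hkn => ?_⟩
  rw [decreasingRearrangement_of_antitone (antitone_eigenvalueVector _),
    decreasingRearrangement_of_antitone (antitone_eigenvalueVector _)]
  have hanti := antitone_eigenvalueVector hC.isHermitian
  -- Indices start at zero, so the `k`-th largest eigenvalue sits at `k - 1`.
  let m : Fin n := ⟨k - 1, by omega⟩
  obtain ⟨t, ht⟩ : ∃ t, t = eigenvalueVector hC.isHermitian m := ⟨_, rfl⟩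
  have htpos : 0 < t := ht ▸ eigenvalueVector_pos hC m
  have htpos' : (0 : ℂ) < (t : ℂ) := by exact_mod_cast htpos
  obtain ⟨B, hCB, htB, hBtr⟩ := exists_truncation hC.isHermitian t
  have hB : B.PosDef := by simpa using hC.add_posSemidef (le_iff_posSemidef.mp hCB)
  obtain ⟨P, hP, hP', hPtr, hPΦ⟩ :=
    exists_topProjection (posDef_pinchingMap hC hR hRI).isHermitian k
  have h₁ := trace_mul_le_trace_mul hP (pinchingMap_mono hC hR hRI hCB)
  -- On the complement of `P`, only the scalar bound `t ≤ Φ_R(t) ≤ Φ_R(B)` is used.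
  have h₂ := trace_mul_le_trace_mul hP' ((smul_one_le_pinchingMap htpos' hR hRI).trans
    (pinchingMap_mono (Matrix.PosDef.one.smul htpos') hR hRI htB))
  have h₃ := trace_pinchingMap_le hB hR hRI
  rw [Matrix.mul_smul, Matrix.mul_one, Matrix.trace_smul, hPtr, Matrix.sub_mul, Matrix.one_mul,
    Matrix.trace_sub, smul_eq_mul] at h₂
  have h₄ := add_le_add (h₁.trans (le_sub_comm.mp h₂)) h₃
  rw [hPΦ, hBtr, ← sub_nonneg] at h₄
  have h₅ : 0 ≤ (∑ i, max (eigenvalueVector hC.isHermitian i) t) -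
      t * (∑ i : Fin n, if i.val < k then 0 else 1) -
      ∑ i : Fin n with i.val < k,
        eigenvalueVector (posDef_pinchingMap hC hR hRI).isHermitian i := by
    rw [← Complex.zero_le_real]
    push_cast at h₄ ⊢
    convert h₄ using 1
    ring
  refine (sub_nonneg.mp h₅).trans (le_of_eq ?_)
  -- Termwise: for `i < k` the maximum is the eigenvalue itself; for `i ≥ k` it is `t` and cancels.
  rw [Finset.mul_sum, ← Finset.sum_sub_distrib, Finset.sum_filter]
  refine Finset.sum_congr rfl fun i _ => ?_
  split_ifs with hi
  · rw [max_eq_left (ht ▸ hanti (Fin.mk_le_mk.mpr (by omega) : i ≤ m))]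
    ring
  · rw [max_eq_right (ht ▸ hanti (Fin.le_def.mpr (by simp only [m]; omega) : m ≤ i))]
    ring
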